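/- Let $d\ge 0$. For a tempered distribution $U$ and a Schwartz function $\varphi$ let $\langle U,\varphi\rangle$ denote the pairing extending $\int U\overline{\varphi}$ (conjugate-linear in $\varphi$). For $f,g\in\mathcal S(\mathbb R^n)$ let $$W(f,g)(x,\xi)=\int_{\mathbb R^n} f(x+\tfrac t2)\,\overline{g(x-\tfrac t2)}\,e^{-2\pi i t\cdot\xi}\,dt$$ be the cross-Wigner distribution, and for $F,G\in\mathcal S'(\mathbb R^n)$ let $W(F,G)\in\mathcal S'(\mathbb R^{2n})$ be its usual extension, i.e. $W(F,G)=\mathcal A(F\otimes\overline G)$, where $\mathcal A\Phi(x,\xi)=\int \Phi(x+\frac t2,x-\frac t2)e^{-2\pi i t\cdot\xi}dt$ is extended from $\mathcal S$ to $\mathcal S'$ by $\langle \mathcal A U,\mathcal A\Phi\rangle=\langle U,\Phi\rangle$. Let $T:\mathcal S(\mathbb R^d)\to\mathcal S'(\mathbb R^d)$ be linear and continuous. A distribution $k\in\mathcal S'(\mathbb R^{4d})$ is the Wigner kernel of $T$ if $$\langle W(Tf,Tg),W(u,v)\rangle=\langle k,\,W(u,v)\otimes\overline{W(f,g)}\rangle\qquad\text{for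 all } f,g,u,v\in\mathcal S(\mathbb R^d).$$ For $S\in Sp(d,\mathbb R)$, we write $T\in FIO(S)$ if the Wigner kernel $k$ of $T$ has the form $k(z,w)=h(z,Sw)$, $z,w\in\mathbb R^{2d}$, where $h\in\mathcal S'(\mathbb R^{4d})$ is the Schwartz kernel of a pseudodifferential operator on $\mathbb R^{2d}$ with (Weyl) symbol $\sigma$ in the Hörmander class $S^0_{0,0}(\mathbb R^{4d})$. That is, $\sigma$ is smooth with all derivatives bounded, and $\langle h,\,G\otimes\overline F\rangle=\langle \sigma,W(G,F)\rangle$ for all $F,G\in\mathcal S(\mathbb R^{2d})$. The adjoint $T^*:\mathcal S(\mathbb R^d)\to\mathcal S'(\mathbb R^d)$ is defined by $\langle T^*f,g\rangle=\overline{\langle Tg,f\rangle}$, $f,g\in\mathcal S(\mathbb R^d)$. **Corollary.** Let $S\in Sp(d,\mathbb R)$ and $T\in FIO(S)$. Then $T^*\in FIO(S^{-1})$. If $k$ is the Wigner kernel of $T$, then the Wigner kernel of $T^*$ is $\tilde k(z,w)=k(w,z)$. Moreover, whenever $T$ is the restriction to $\mathcal S(\mathbb R^d)$ of a bounded operator $A$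 on $L^2(\mathbb R^d)$, $T^*$ is the restriction of the Hilbert space adjoint of $A$. -/

import Mathlib

open SchwartzMap MeasureTheory

namespace WignerFIO

open scoped ContDiff ComplexConjugate FourierTransform

noncomputable section

/-! ### Continuous operators of Schwartz spaces acting on one group of variables -/

/-- Second order Taylor estimate for all Schwartz seminorms. -/
theorem schwartz_taylor {E : Type} [NormedAddCommGroup E] [NormedSpace ℝ E] (n : ℕ) :
    ∀ {F : Type} [NormedAddCommGroup F] [NormedSpace ℝ F] (f : 𝓢(E, F)) (k : ℕ),
    ∃ C : ℝ, 0 ≤ C ∧ ∀ h z : E, ‖h‖ ≤ 1 →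
      ‖z‖ ^ k * ‖iteratedFDeriv ℝ n (fun z => f (z + h) - f z - fderiv ℝ f z h) z‖ ≤
        C * ‖h‖ ^ 2 := by
  induction n with
  | zero =>
    intro F _ _ f k
    let M : ℝ := 2 ^ k * (2 ^ k * (Finset.Iic (k, 2)).sup
      (fun m => SchwartzMap.seminorm ℝ m.1 m.2) f)
    have hM : 0 ≤ M := by positivity
    refine ⟨M, hM, fun h z hh => ?_⟩
    have key : ∀ t ∈ segment ℝ z (z + h),
        ‖z‖ ^ k * ‖iteratedFDeriv ℝ 2 f t‖ ≤ M := by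
      intro t ht
      have h1 : ‖z‖ ≤ 2 * (1 + ‖t‖) := by
        have : ‖t - z‖ ≤ ‖h‖ := by
          obtain ⟨s, ⟨hs0, hs1⟩, rfl⟩ := (segment_eq_image' ℝ z (z + h)) ▸ ht
          simp only [add_sub_cancel_left, norm_smul, Real.norm_eq_abs, abs_of_nonneg hs0]
          exact mul_le_of_le_one_left (norm_nonneg _) hs1
        have h2 : ‖z‖ ≤ ‖t‖ + ‖t - z‖ := by
          have := norm_sub_le t (t - z); simpa using this
        have := norm_nonneg t
        linarith
      calc ‖z‖ ^ k * ‖iteratedFDeriv ℝ 2 f t‖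
          ≤ (2 * (1 + ‖t‖)) ^ k * ‖iteratedFDeriv ℝ 2 f t‖ := by gcongr
        _ = 2 ^ k * ((1 + ‖t‖) ^ k * ‖iteratedFDeriv ℝ 2 f t‖) := by rw [mul_pow]; ring
        _ ≤ M := by
          have := one_add_le_sup_seminorm_apply (𝕜 := ℝ) (m := (k, 2)) le_rfl le_rfl f t
          exact mul_le_mul_of_nonneg_left this (by positivity)
    have hd2 : ∀ t, ‖fderiv ℝ (fderiv ℝ f) t‖ = ‖iteratedFDeriv ℝ 2 f t‖ := by
      intro t
      rw [← norm_iteratedFDeriv_fderiv, ← norm_fderiv_iteratedFDeriv]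
      have := norm_iteratedFDeriv_fderiv (𝕜 := ℝ) (f := fderiv ℝ f) (x := t) (n := 0)
      rw [norm_fderiv_iteratedFDeriv, ← this, norm_iteratedFDeriv_zero]
    have hdf : ∀ t, DifferentiableAt ℝ (fderiv ℝ f) t := fun t =>
      (fderivCLM ℝ E F f).differentiableAt
    have hcz : z ∈ segment ℝ z (z + h) := left_mem_segment _ _ _
    have hch : z + h ∈ segment ℝ z (z + h) := right_mem_segment _ _ _
    have step1 : ∀ t ∈ segment ℝ z (z + h),
        ‖z‖ ^ k * ‖fderiv ℝ f t - fderiv ℝ f z‖ ≤ M * ‖h‖ := by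
      intro t ht
      have := (convex_segment z (z + h)).norm_image_sub_le_of_norm_fderiv_le (𝕜 := ℝ)
        (f := fun t => ‖z‖ ^ k • fderiv ℝ f t) (C := M) (x := z) (y := t)
        (fun t _ => (hdf t).fun_const_smul _) (fun t ht => by
          rw [fderiv_fun_const_smul (hdf t), norm_smul, hd2]
          simpa using key t ht) hcz ht
      rw [← smul_sub, norm_smul] at this
      have h3 : ‖t - z‖ ≤ ‖h‖ := by
        obtain ⟨s, ⟨hs0, hs1⟩, rfl⟩ := (segment_eq_image' ℝ z (z + h)) ▸ ht
        simp only [add_sub_cancel_left, norm_smul, Real.norm_eq_abs, abs_of_nonneg hs0]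
        exact mul_le_of_le_one_left (norm_nonneg _) hs1
      calc _ ≤ M * ‖t - z‖ := by simpa using this
        _ ≤ _ := by gcongr
    have step2 := (convex_segment z (z + h)).norm_image_sub_le_of_norm_hasFDerivWithin_le
        (𝕜 := ℝ)
        (f := fun t => ‖z‖ ^ k • (f t - fderiv ℝ f z t))
        (f' := fun t => ‖z‖ ^ k • (fderiv ℝ f t - fderiv ℝ f z))
        (C := M * ‖h‖) (x := z) (y := z + h)
        (fun t _ => (((f.hasFDerivAt t).sub (fderiv ℝ f z).hasFDerivAt).const_smul
          _).hasFDerivWithinAt) (fun t ht => by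
            rw [norm_smul]; simpa using step1 t ht) hcz hch
    rw [norm_iteratedFDeriv_zero]
    rw [← smul_sub, norm_smul] at step2
    have e : f (z + h) - (fderiv ℝ f z) (z + h) - (f z - (fderiv ℝ f z) z)
        = f (z + h) - f z - fderiv ℝ f z h := by
      rw [(fderiv ℝ f z).map_add]; abel
    rw [e] at step2
    calc _ ≤ M * ‖h‖ * ‖h‖ := by simpa using step2
      _ = _ := by ring
  | succ n ih =>
    intro F _ _ f k
    obtain ⟨C, hC, H⟩ := ih (fderivCLM ℝ E F f) k
    refine ⟨C, hC, fun h z hh => ?_⟩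
    have hdf : ∀ t, DifferentiableAt ℝ (fderiv ℝ f) t := fun t =>
      (fderivCLM ℝ E F f).differentiableAt
    have e : fderiv ℝ (fun z => f (z + h) - f z - fderiv ℝ f z h) =
        fun z => fderivCLM ℝ E F f (z + h) - fderivCLM ℝ E F f z -
          fderiv ℝ (fderivCLM ℝ E F f) z h := by
      funext t
      have h1 : HasFDerivAt (fun z => f (z + h)) (fderiv ℝ f (t + h)) t :=
        (hasFDerivAt_comp_add_right h).2 (f.hasFDerivAt (t + h))
      have h2 : HasFDerivAt (fun z => fderiv ℝ f z h)
          ((fderiv ℝ (fderiv ℝ f) t).flip h) t := by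
        have := (hdf t).hasFDerivAt.clm_apply (hasFDerivAt_const h t)
        simpa using this
      rw [((h1.fun_sub (f.hasFDerivAt t)).fun_sub h2).fderiv]
      ext v
      have sym : IsSymmSndFDerivAt ℝ f t :=
        ((f.smooth 2).contDiffAt).isSymmSndFDerivAt (by
          rw [minSmoothness_of_isRCLikeNormedField]
          exact le_rfl)
      have := sym.eq v h
      simp only [sub_apply, ContinuousLinearMap.flip_apply]
      rw [this]
      rfl
    rw [← norm_iteratedFDeriv_fderiv, e]
    exact H h z hh

theorem seminorm_sum_apply {E ι : Type} [AddCommGroup E] [Module ℂ E] (s : Finset ι)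
    (p : ι → Seminorm ℂ E) (u : E) : (∑ i ∈ s, p i) u = ∑ i ∈ s, p i u := by
  classical
  induction s using Finset.induction_on with
  | empty => simp
  | insert a s ha ih => rw [Finset.sum_insert ha, Finset.sum_insert ha, ← ih]; rfl

/-- Every continuous seminorm is dominated by a finite sum of Schwartz seminorms -/
theorem schwartz_seminorm_le {E : Type} [NormedAddCommGroup E] [NormedSpace ℝ E]
    (r : Seminorm ℂ 𝓢(E, ℂ)) (hr : Continuous r) :
    ∃ (s : Finset (ℕ × ℕ)) (C : ℝ), 0 ≤ C ∧
      ∀ f, r f ≤ C * ∑ i ∈ s, SchwartzMap.seminorm ℂ i.1 i.2 f := by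
  obtain ⟨s, C, -, h⟩ := Seminorm.bound_of_continuous (schwartz_withSeminorms ℂ E ℂ) r hr
  refine ⟨s, C, C.2, fun f => (h f).trans ?_⟩
  change (C : ℝ) * (s.sup (schwartzSeminormFamily ℂ E ℂ)) f ≤ _
  gcongr
  have := Seminorm.finset_sup_le_sum (schwartzSeminormFamily ℂ E ℂ) s f
  refine this.trans (le_of_eq ?_)
  rw [seminorm_sum_apply]
  rfl

theorem schwartz_taylor_seminorm {E : Type} [NormedAddCommGroup E] [NormedSpace ℝ E]
    (r : Seminorm ℂ 𝓢(E, ℂ)) (hr : Continuous r) (f : 𝓢(E, ℂ)) :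
    ∃ C : ℝ, 0 ≤ C ∧ ∀ h : E, ‖h‖ ≤ 1 →
      r (compSubConstCLM ℂ (-h) f - f - LineDeriv.lineDerivOp h f) ≤ C * ‖h‖ ^ 2 := by
  obtain ⟨s, C, hC, hs⟩ := schwartz_seminorm_le r hr
  choose K hK0 hK using fun i : ℕ × ℕ => schwartz_taylor i.2 f i.1
  refine ⟨C * ∑ i ∈ s, K i, mul_nonneg hC (Finset.sum_nonneg fun i _ => hK0 i), fun h hh => ?_⟩
  refine (hs _).trans ?_
  rw [mul_assoc, Finset.sum_mul]
  gcongr with i hi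
  refine seminorm_le_bound ℂ _ _ _ (mul_nonneg (hK0 i) (by positivity)) fun z => ?_
  have e : ⇑(compSubConstCLM ℂ (-h) f - f - LineDeriv.lineDerivOp h f) =
      fun z => f (z + h) - f z - fderiv ℝ f z h := by
    funext z; simp [lineDerivOp_apply_eq_fderiv]
  rw [e]; exact hK i h z hh

/-- A family of functions depending on a Schwartz function, closed (up to sums of two members) under
directional derivatives and with rapid decay, consists of Schwartz functions. -/
theorem schwartz_family {D E : Type} [NormedAddCommGroup D] [NormedSpace ℝ D]
    [NormedAddCommGroup E] [NormedSpace ℝ E] [FiniteDimensional ℝ E]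
    (𝒞 : Set (𝓢(D, ℂ) → E → ℂ))
    (hdiff : ∀ Φ ∈ 𝒞, ∀ u, Differentiable ℝ (Φ u))
    (hder : ∀ Φ ∈ 𝒞, ∀ v, ∃ Φ₁ ∈ 𝒞, ∃ Φ₂ ∈ 𝒞, ∀ u x,
      fderiv ℝ (Φ u) x v = Φ₁ u x + Φ₂ u x)
    (hbd : ∀ Φ ∈ 𝒞, ∀ k : ℕ, ∃ q : Seminorm ℂ 𝓢(D, ℂ), Continuous q ∧
      ∀ u x, ‖x‖ ^ k * ‖Φ u x‖ ≤ q u) :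
    (∀ Φ ∈ 𝒞, ∀ u, ContDiff ℝ ∞ (Φ u)) ∧
    ∀ Φ ∈ 𝒞, ∀ n : ℕ × ℕ, ∃ (s : Finset (ℕ × ℕ)) (C : ℝ), 0 ≤ C ∧ ∀ u x,
      ‖x‖ ^ n.1 * ‖iteratedFDeriv ℝ n.2 (Φ u) x‖ ≤
        C * s.sup (schwartzSeminormFamily ℂ D ℂ) u := by
  have sm : ∀ n : ℕ, ∀ Φ ∈ 𝒞, ∀ u, ContDiff ℝ n (Φ u) := by
    intro n
    induction n with
    | zero => exact fun Φ hΦ u => contDiff_zero.2 (hdiff Φ hΦ u).continuous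
    | succ n ih =>
      intro Φ hΦ u
      have : ((n + 1 : ℕ) : WithTop ℕ∞) = (n : WithTop ℕ∞) + 1 := by norm_cast
      rw [this, contDiff_succ_iff_fderiv]
      refine ⟨hdiff Φ hΦ u, by simp, ?_⟩
      rw [contDiff_clm_apply_iff]
      intro v
      obtain ⟨Φ₁, h₁, Φ₂, h₂, e⟩ := hder Φ hΦ v
      simp only [e]
      exact (ih Φ₁ h₁ u).add (ih Φ₂ h₂ u)
  have bd : ∀ n : ℕ, ∀ Φ ∈ 𝒞, ∀ k : ℕ, ∃ q : Seminorm ℂ 𝓢(D, ℂ), Continuous q ∧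
      ∀ u x, ‖x‖ ^ k * ‖iteratedFDeriv ℝ n (Φ u) x‖ ≤ q u := by
    intro n
    induction n with
    | zero => simpa using hbd
    | succ n ih =>
      intro Φ hΦ k
      let b := Module.finBasis ℝ E
      choose Φ₁ h₁ Φ₂ h₂ e using fun i => hder Φ hΦ (b i)
      choose q₁ hq₁ H₁ using fun i => ih (Φ₁ i) (h₁ i) k
      choose q₂ hq₂ H₂ using fun i => ih (Φ₂ i) (h₂ i) k
      let L : Fin (Module.finrank ℝ E) → ℂ →L[ℝ] (E →L[ℝ] ℂ) := fun i =>
        ContinuousLinearMap.smulRightL ℝ E ℂ (LinearMap.toContinuousLinearMap (b.coord i))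
      refine ⟨∑ i, ‖L i‖₊ • (q₁ i + q₂ i), ?_, fun u x => ?_⟩
      · have : ⇑(∑ i, ‖L i‖₊ • (q₁ i + q₂ i)) =
            fun u => ∑ i, (‖L i‖₊ : ℝ) * (q₁ i u + q₂ i u) := by
          funext u
          rw [seminorm_sum_apply]
          rfl
        rw [this]
        exact continuous_finsetSum _ fun i _ => continuous_const.mul ((hq₁ i).add (hq₂ i))
      · have ef : fderiv ℝ (Φ u) = fun x => ∑ i, (⇑(L i) ∘ (Φ₁ i u + Φ₂ i u)) x := by
          funext x
          refine ContinuousLinearMap.coe_injective (b.ext fun j => ?_)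
          have hL : ∀ i c v, L i c v = (b.coord i v) • c := fun _ _ _ => rfl
          simp only [ContinuousLinearMap.coe_coe, sum_apply, Function.comp_apply, Pi.add_apply,
            hL, e]
          rw [Finset.sum_eq_single j]
          · simp
          · intro i _ hij
            simp [hij.symm]
          · simp
        have sm' : ∀ i, ContDiff ℝ n (Φ₁ i u + Φ₂ i u) := fun i =>
          (sm n _ (h₁ i) u).add (sm n _ (h₂ i) u)
        have ev : (∑ i, ‖L i‖₊ • (q₁ i + q₂ i)) u =
            ∑ i, (‖L i‖₊ : ℝ) * (q₁ i u + q₂ i u) := by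
          rw [seminorm_sum_apply]
          rfl
        rw [← norm_iteratedFDeriv_fderiv, ef, ev,
          iteratedFDeriv_fun_sum_apply
            (fun i _ => ((L i).contDiff.comp (sm' i)).contDiffAt)]
        calc _ ≤ ‖x‖ ^ k * ∑ i, ‖iteratedFDeriv ℝ n (⇑(L i) ∘ (Φ₁ i u + Φ₂ i u)) x‖ := by
              gcongr; exact norm_sum_le _ _
          _ = ∑ i, ‖x‖ ^ k * ‖iteratedFDeriv ℝ n (⇑(L i) ∘ (Φ₁ i u + Φ₂ i u)) x‖ :=
              Finset.mul_sum _ _ _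
          _ ≤ _ := by
              refine Finset.sum_le_sum fun i _ => ?_
              rw [(L i).iteratedFDeriv_comp_left (sm' i).contDiffAt le_rfl,
                iteratedFDeriv_add_apply (sm n _ (h₁ i) u).contDiffAt
                  (sm n _ (h₂ i) u).contDiffAt]
              calc _ ≤ ‖x‖ ^ k * (‖L i‖ * (‖iteratedFDeriv ℝ n (Φ₁ i u) x‖ +
                    ‖iteratedFDeriv ℝ n (Φ₂ i u) x‖)) := by
                    gcongr
                    refine ((L i).norm_compContinuousMultilinearMap_le _).trans ?_
                    gcongr
                    exact norm_add_le _ _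
                _ = ‖L i‖ * (‖x‖ ^ k * ‖iteratedFDeriv ℝ n (Φ₁ i u) x‖ +
                    ‖x‖ ^ k * ‖iteratedFDeriv ℝ n (Φ₂ i u) x‖) := by ring
                _ ≤ _ := by
                    rw [coe_nnnorm]
                    gcongr
                    · exact H₁ i u x
                    · exact H₂ i u x
  refine ⟨fun Φ hΦ u => contDiff_infty.2 fun n => sm n Φ hΦ u, fun Φ hΦ n => ?_⟩
  obtain ⟨q, hq, H⟩ := bd n.2 Φ hΦ n.1
  obtain ⟨s, C, -, h⟩ := Seminorm.bound_of_continuous (schwartz_withSeminorms ℂ D ℂ) q hq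
  exact ⟨s, C, C.2, fun u x => (H u x).trans (h u)⟩

variable {E₁ E₂ E₃ : Type}
  [NormedAddCommGroup E₁] [NormedSpace ℝ E₁] [NormedAddCommGroup E₂] [NormedSpace ℝ E₂]
  [NormedAddCommGroup E₃] [NormedSpace ℝ E₃]

/-- The slice `Ψ ↦ Ψ (x, ·)`. -/
def sliceCLM (x : E₁) : 𝓢(E₁ × E₂, ℂ) →L[ℂ] 𝓢(E₂, ℂ) :=
  compCLMOfAntilipschitz (K := 1) (g := fun y : E₂ => (x, y)) ℂ
    (by
      have h := (Function.HasTemperateGrowth.const (x, (0 : E₂))).add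
        (ContinuousLinearMap.inr ℝ E₁ E₂).hasTemperateGrowth
      have e : ((fun _ : E₂ => (x, (0 : E₂))) + ⇑(ContinuousLinearMap.inr ℝ E₁ E₂)) =
        fun y : E₂ => (x, y) := by funext y; simp
      rwa [e] at h)
    (fun y y' => by simp [edist_dist, Prod.dist_eq])

theorem sliceCLM_apply (x : E₁) (Ψ : 𝓢(E₁ × E₂, ℂ)) (y : E₂) : sliceCLM x Ψ y = Ψ (x, y) := rfl

theorem sliceCLM_bound (r : Seminorm ℂ 𝓢(E₂, ℂ)) (hr : Continuous r) (k : ℕ) :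
    ∃ q : Seminorm ℂ 𝓢(E₁ × E₂, ℂ), Continuous q ∧
      ∀ Ψ (x : E₁), ‖x‖ ^ k * r (sliceCLM x Ψ) ≤ q Ψ := by
  obtain ⟨s, C, hC, hs⟩ := schwartz_seminorm_le r hr
  lift C to NNReal using hC
  have ev : ∀ Ψ, (C • ∑ i ∈ s, SchwartzMap.seminorm ℂ (E := E₁ × E₂) (F := ℂ) (i.1 + k) i.2) Ψ =
      C * ∑ i ∈ s, SchwartzMap.seminorm ℂ (i.1 + k) i.2 Ψ := by
    intro Ψ
    rw [← seminorm_sum_apply]; rfl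
  refine ⟨C • ∑ i ∈ s, SchwartzMap.seminorm ℂ (i.1 + k) i.2, ?_, fun Ψ x => ?_⟩
  · rw [show ⇑(C • ∑ i ∈ s, SchwartzMap.seminorm ℂ (E := E₁ × E₂) (F := ℂ) (i.1 + k) i.2) = _ from
      funext ev]
    refine continuous_const.mul (continuous_finsetSum _ fun i _ => ?_)
    exact (schwartz_withSeminorms ℂ (E₁ × E₂) ℂ).continuous_seminorm (i.1 + k, i.2)
  · rw [ev]
    calc _ ≤ ‖x‖ ^ k * (C * ∑ i ∈ s, SchwartzMap.seminorm ℂ i.1 i.2 (sliceCLM x Ψ)) := by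
          gcongr; exact hs _
      _ = C * ∑ i ∈ s, ‖x‖ ^ k * SchwartzMap.seminorm ℂ i.1 i.2 (sliceCLM x Ψ) := by
          rw [← Finset.mul_sum]; ring
      _ ≤ _ := by
          gcongr with i hi
          rcases eq_or_ne (‖x‖ ^ k) 0 with h0 | h0
          · rw [h0, zero_mul]; positivity
          have hpos : 0 < ‖x‖ ^ k := lt_of_le_of_ne (by positivity) h0.symm
          rw [mul_comm, ← le_div_iff₀ hpos]
          refine seminorm_le_bound ℂ _ _ _ (by positivity) fun y => ?_
          rw [le_div_iff₀ hpos]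
          have e : ⇑(sliceCLM x Ψ) =
              (fun p => Ψ ((x, 0) + p)) ∘ (ContinuousLinearMap.inr ℝ E₁ E₂) := by
            funext y; simp [sliceCLM_apply]
          have sm : ContDiff ℝ ∞ (fun p => Ψ ((x, 0) + p)) :=
            (Ψ.smooth ⊤).comp (contDiff_const.add contDiff_id)
          rw [e, (ContinuousLinearMap.inr ℝ E₁ E₂).iteratedFDeriv_comp_right sm _
            (by exact_mod_cast le_top), iteratedFDeriv_comp_add_left]
          have h1 : (x, (0 : E₂)) + (ContinuousLinearMap.inr ℝ E₁ E₂) y = (x, y) := by simp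
          rw [h1]
          have h2 : ‖(iteratedFDeriv ℝ i.2 Ψ (x, y)).compContinuousLinearMap
              fun _ => ContinuousLinearMap.inr ℝ E₁ E₂‖ ≤ ‖iteratedFDeriv ℝ i.2 Ψ (x, y)‖ := by
            refine (ContinuousMultilinearMap.norm_compContinuousLinearMap_le _ _).trans ?_
            refine mul_le_of_le_one_right (norm_nonneg _) ?_
            exact Finset.prod_le_one (fun _ _ => norm_nonneg _)
              fun _ _ => ContinuousLinearMap.norm_inr_le_one ℝ E₁ E₂
          calc _ ≤ ‖(x, y)‖ ^ i.1 * ‖iteratedFDeriv ℝ i.2 Ψ (x, y)‖ * ‖(x, y)‖ ^ k := by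
                gcongr
                · exact le_max_right _ _
                · exact le_max_left _ _
            _ = ‖(x, y)‖ ^ (i.1 + k) * ‖iteratedFDeriv ℝ i.2 Ψ (x, y)‖ := by rw [pow_add]; ring
            _ ≤ _ := le_seminorm ℂ _ _ _ _

open Asymptotics in
theorem partial_hasFDerivAt [FiniteDimensional ℝ E₁] (B : 𝓢(E₂, ℂ) →L[ℂ] 𝓢(E₃, ℂ))
    (Ψ : 𝓢(E₁ × E₂, ℂ)) (p : E₁ × E₃) :
    ∃ L : E₁ × E₃ →L[ℝ] ℂ,
      HasFDerivAt (fun p : E₁ × E₃ => B (sliceCLM p.1 Ψ) p.2) L p ∧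
      ∀ v : E₁ × E₃, L v =
        B (sliceCLM p.1 (LineDeriv.lineDerivOp (v.1, (0 : E₂)) Ψ)) p.2 +
        LineDeriv.lineDerivOp v.2 (B (sliceCLM p.1 Ψ)) p.2 := by
  obtain ⟨x, ξ⟩ := p
  let b := Module.finBasis ℝ E₁
  let c : Fin (Module.finrank ℝ E₁) → E₁ →L[ℝ] ℝ :=
    fun i => LinearMap.toContinuousLinearMap (b.coord i)
  let G : Fin (Module.finrank ℝ E₁) → 𝓢(E₃, ℂ) := fun i =>
    B (sliceCLM x (LineDeriv.lineDerivOp (b i, (0 : E₂)) Ψ))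
  have hG : ∀ (h : E₁), B (sliceCLM x (LineDeriv.lineDerivOp (h, (0 : E₂)) Ψ)) =
      ∑ i, c i h • G i := by
    intro h
    have e1 : LineDeriv.lineDerivOp (h, (0 : E₂)) Ψ =
        ∑ i, ((c i h : ℝ) : ℂ) • LineDeriv.lineDerivOp (b i, (0 : E₂)) Ψ := by
      have e2 : (h, (0 : E₂)) = ∑ i, c i h • (b i, (0 : E₂)) := by
        have := b.sum_repr h
        ext
        · simp only [Prod.smul_mk, smul_zero, Prod.fst_sum]; exact this.symm
        · simp [Prod.snd_sum]
      conv_lhs => rw [e2]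
      rw [LineDeriv.lineDerivOp_left_sum]
      refine Finset.sum_congr rfl fun i _ => ?_
      rw [LineDeriv.lineDerivOp_left_smul]
      ext; simp
    rw [e1, map_sum, map_sum]
    refine Finset.sum_congr rfl fun i _ => ?_
    rw [(sliceCLM x).map_smul, B.map_smul]
    ext; simp [G]
  let R : E₁ × E₃ → ℂ := fun p =>
    B (sliceCLM x (compSubConstCLM ℂ (-(p.1 - x, (0 : E₂))) Ψ - Ψ -
      LineDeriv.lineDerivOp (p.1 - x, (0 : E₂)) Ψ)) p.2
  have hR : HasFDerivAt R (0 : E₁ × E₃ →L[ℝ] ℂ) (x, ξ) := by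
    let r : Seminorm ℂ 𝓢(E₁ × E₂, ℂ) := (SchwartzMap.seminorm ℂ (E := E₃) (F := ℂ) 0 0).comp
      (B.comp (sliceCLM (E₂ := E₂) x)).toLinearMap
    have hr : Continuous r :=
      ((schwartz_withSeminorms ℂ E₃ ℂ).continuous_seminorm (0, 0)).comp
        (B.comp (sliceCLM (E₂ := E₂) x)).continuous
    obtain ⟨C, hC, H⟩ := schwartz_taylor_seminorm r hr Ψ
    refine IsBigO.hasFDerivAt (n := 2) ?_ (by norm_num)
    refine IsBigO.of_bound C ?_
    filter_upwards [Metric.ball_mem_nhds (x, ξ) one_pos] with p hp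
    have h1 : ‖p.1 - x‖ ≤ ‖p - (x, ξ)‖ := le_max_left ‖p.1 - x‖ ‖p.2 - ξ‖
    have hp' : ‖p - (x, ξ)‖ < 1 := by rwa [mem_ball_iff_norm] at hp
    have h2 : ‖(p.1 - x, (0 : E₂))‖ = ‖p.1 - x‖ := by simp [Prod.norm_def]
    calc ‖R p‖ ≤ r _ := norm_le_seminorm ℂ _ _
      _ ≤ C * ‖(p.1 - x, (0 : E₂))‖ ^ 2 := H _ (by rw [h2]; linarith)
      _ ≤ C * ‖‖p - (x, ξ)‖ ^ 2‖ := by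
        rw [h2, norm_pow, norm_norm]; gcongr
  have dec : (fun p : E₁ × E₃ => B (sliceCLM p.1 Ψ) p.2) = fun p =>
      R p + B (sliceCLM x Ψ) p.2 + ∑ i, c i (p.1 - x) • G i p.2 := by
    funext p
    have e1 : sliceCLM p.1 Ψ = sliceCLM x (compSubConstCLM ℂ (-(p.1 - x, (0 : E₂))) Ψ) := by
      ext y; simp [sliceCLM_apply]
    have e2 : ∑ i, c i (p.1 - x) • G i p.2 =
        B (sliceCLM x (LineDeriv.lineDerivOp (p.1 - x, (0 : E₂)) Ψ)) p.2 := by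
      rw [hG, sum_apply]
      rfl
    rw [e2, e1]
    simp only [R, map_sub, sub_apply]
    ring
  have hg : HasFDerivAt (fun p : E₁ × E₃ => B (sliceCLM x Ψ) p.2)
      ((fderiv ℝ (B (sliceCLM x Ψ)) ξ).comp (ContinuousLinearMap.snd ℝ E₁ E₃)) (x, ξ) :=
    ((B (sliceCLM x Ψ)).hasFDerivAt ξ).comp (x, ξ) hasFDerivAt_snd
  have hs : HasFDerivAt (fun p : E₁ × E₃ => ∑ i, c i (p.1 - x) • G i p.2)
      (∑ i, (((c i).comp (ContinuousLinearMap.fst ℝ E₁ E₃)).smulRight (G i ξ))) (x, ξ) := by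
    refine HasFDerivAt.fun_sum fun i _ => ?_
    have h1 : HasFDerivAt (fun p : E₁ × E₃ => c i (p.1 - x))
        ((c i).comp (ContinuousLinearMap.fst ℝ E₁ E₃)) (x, ξ) :=
      (c i).hasFDerivAt.comp (x, ξ) (hasFDerivAt_fst.sub_const x)
    have h2 : HasFDerivAt (fun p : E₁ × E₃ => G i p.2)
        ((fderiv ℝ (G i) ξ).comp (ContinuousLinearMap.snd ℝ E₁ E₃)) (x, ξ) :=
      ((G i).hasFDerivAt ξ).comp (x, ξ) hasFDerivAt_snd
    refine (h1.fun_smul h2).congr_fderiv ?_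
    ext v <;> simp
  refine ⟨_, dec ▸ ((hR.fun_add hg).fun_add hs), fun v => ?_⟩
  rw [hG, sum_apply]
  simp only [zero_add, add_apply, sum_apply, ContinuousLinearMap.comp_apply,
    lineDerivOp_apply_eq_fderiv]
  rw [add_comm]
  rfl

/-- The operator `B` acting on the second variable: `(x, ξ) ↦ B (Ψ (x, ·)) ξ`. -/
def partialCLM [FiniteDimensional ℝ E₁] [FiniteDimensional ℝ E₃]
    (B : 𝓢(E₂, ℂ) →L[ℂ] 𝓢(E₃, ℂ)) : 𝓢(E₁ × E₂, ℂ) →L[ℂ] 𝓢(E₁ × E₃, ℂ) :=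
  have key := schwartz_family (D := E₁ × E₂) (E := E₁ × E₃)
    {Φ | ∃ (A : 𝓢(E₁ × E₂, ℂ) →L[ℂ] 𝓢(E₁ × E₂, ℂ)) (B : 𝓢(E₂, ℂ) →L[ℂ] 𝓢(E₃, ℂ)),
      Φ = fun u p => B (sliceCLM p.1 (A u)) p.2}
    (by
      rintro _ ⟨A, B, rfl⟩ u p
      obtain ⟨L, hL, -⟩ := partial_hasFDerivAt B (A u) p
      exact hL.differentiableAt)
    (by
      rintro _ ⟨A, B, rfl⟩ v
      refine ⟨_, ⟨(LineDeriv.lineDerivOpCLM ℂ 𝓢(E₁ × E₂, ℂ) (v.1, (0 : E₂))).comp A, B, rfl⟩,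
        _, ⟨A, (LineDeriv.lineDerivOpCLM ℂ 𝓢(E₃, ℂ) v.2).comp B, rfl⟩, fun u p => ?_⟩
      obtain ⟨L, hL, e⟩ := partial_hasFDerivAt B (A u) p
      rw [hL.fderiv, e]
      rfl)
    (by
      rintro _ ⟨A, B, rfl⟩ k
      have hc : ∀ j, Continuous ((SchwartzMap.seminorm ℂ (E := E₃) (F := ℂ) j 0).comp B.toLinearMap) :=
        fun j => ((schwartz_withSeminorms ℂ E₃ ℂ).continuous_seminorm (j, 0)).comp B.continuous
      obtain ⟨q₁, h₁, H₁⟩ := sliceCLM_bound (E₁ := E₁) _ (hc 0) k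
      obtain ⟨q₂, h₂, H₂⟩ := sliceCLM_bound (E₁ := E₁) _ (hc k) 0
      refine ⟨(q₁ + q₂).comp A.toLinearMap, (h₁.add h₂).comp A.continuous, fun u p => ?_⟩
      have hn : ‖p‖ ^ k ≤ ‖p.1‖ ^ k + ‖p.2‖ ^ k := by
        rw [Prod.norm_def]
        rcases max_choice ‖p.1‖ ‖p.2‖ with h | h <;> rw [h]
        · exact le_add_of_nonneg_right (by positivity)
        · exact le_add_of_nonneg_left (by positivity)
      calc _ ≤ (‖p.1‖ ^ k + ‖p.2‖ ^ k) * ‖B (sliceCLM p.1 (A u)) p.2‖ := by gcongr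
        _ = ‖p.1‖ ^ k * ‖B (sliceCLM p.1 (A u)) p.2‖ +
            ‖p.1‖ ^ 0 * (‖p.2‖ ^ k * ‖B (sliceCLM p.1 (A u)) p.2‖) := by ring
        _ ≤ q₁ (A u) + q₂ (A u) := by
          refine add_le_add (le_trans ?_ (H₁ (A u) p.1)) (le_trans ?_ (H₂ (A u) p.1))
          · gcongr
            exact norm_le_seminorm ℂ _ _
          · gcongr
            exact norm_pow_mul_le_seminorm ℂ _ _ _)
  mkCLM (fun u p => B (sliceCLM p.1 u) p.2) (fun f g x => by simp) (fun a f x => by simp)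
    (fun u => key.1 _ ⟨.id ℂ _, B, rfl⟩ u) (fun n => key.2 _ ⟨.id ℂ _, B, rfl⟩ n)

theorem partialCLM_apply [FiniteDimensional ℝ E₁] [FiniteDimensional ℝ E₃]
    (B : 𝓢(E₂, ℂ) →L[ℂ] 𝓢(E₃, ℂ)) (Ψ : 𝓢(E₁ × E₂, ℂ)) (x : E₁) (ξ : E₃) :
    partialCLM B Ψ (x, ξ) = B (sliceCLM x Ψ) ξ := rfl

/-! ### Complex conjugation and the sesquilinear pairing -/

/-- The complex conjugate `x ↦ conj (f x)` of a Schwartz function. -/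
def conjS {E : Type} [NormedAddCommGroup E] [NormedSpace ℝ E] : 𝓢(E, ℂ) →L[ℝ] 𝓢(E, ℂ) :=
  postcompCLM (𝕜 := ℝ) (Complex.conjCLE : ℂ →L[ℝ] ℂ)

section Conj
variable {E : Type} [NormedAddCommGroup E] [NormedSpace ℝ E]

@[simp] theorem conjS_apply (f : 𝓢(E, ℂ)) (x : E) : conjS f x = conj (f x) := rfl

@[simp] theorem conjS_conjS (f : 𝓢(E, ℂ)) : conjS (conjS f) = f := by ext x; simp

theorem conjS_smul (c : ℂ) (f : 𝓢(E, ℂ)) : conjS (c • f) = conj c • conjS f := by ext x; simp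

/-- The pairing `⟨U, φ⟩` of a tempered distribution with a Schwartz function which extends the
`L²` inner product `∫ U conj φ` (conjugate-linear in the second argument). -/
def pair (U : 𝓢'(E, ℂ)) (φ : 𝓢(E, ℂ)) : ℂ := U (conjS φ)

/-- The complex conjugate of a tempered distribution, `⟨conj G, φ⟩ = conj ⟨G, conj φ⟩`. -/
def conjDist (G : 𝓢'(E, ℂ)) : 𝓢'(E, ℂ) :=
  ContinuousLinearMap.toPointwiseConvergenceCLM _ _ _ _
    { toFun := fun φ => conj (G (conjS φ))
      map_add' := fun φ ψ => by rw [map_add, map_add, map_add]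
      map_smul' := fun c φ => by rw [conjS_smul, map_smul]; simp
      cont := Complex.continuous_conj.comp (G.continuous.comp conjS.continuous) }

theorem conjDist_apply (G : 𝓢'(E, ℂ)) (φ : 𝓢(E, ℂ)) : conjDist G φ = conj (G (conjS φ)) := rfl

/-- The extension of a topological isomorphism `A` of Schwartz spaces (in applications, the
restriction of a unitary operator between `L²` spaces) to tempered distributions, given by
`⟨A U, A φ⟩ = ⟨U, φ⟩`, that is, `⟨A U, φ⟩ = ⟨U, A⁻¹ φ⟩`. -/
def extendUnitary {E' : Type} [NormedAddCommGroup E'] [NormedSpace ℝ E']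
    (A : 𝓢(E, ℂ) ≃L[ℂ] 𝓢(E', ℂ)) (U : 𝓢'(E, ℂ)) : 𝓢'(E', ℂ) :=
  ContinuousLinearMap.toPointwiseConvergenceCLM _ _ _ _
    { toFun := fun φ => U (conjS (A.symm (conjS φ)))
      map_add' := fun φ ψ => by rw [map_add, map_add, map_add, map_add]
      map_smul' := fun c φ => by rw [conjS_smul, map_smul, conjS_smul, map_smul]; simp
      cont := U.continuous.comp
        (conjS.continuous.comp (A.symm.continuous.comp conjS.continuous)) }

theorem pair_extendUnitary {E' : Type} [NormedAddCommGroup E'] [NormedSpace ℝ E']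
    (A : 𝓢(E, ℂ) ≃L[ℂ] 𝓢(E', ℂ)) (U : 𝓢'(E, ℂ)) (φ : 𝓢(E', ℂ)) :
    pair (extendUnitary A U) φ = pair U (A.symm φ) := by
  change U (conjS (A.symm (conjS (conjS φ)))) = _
  rw [conjS_conjS]; rfl

end Conj

/-! ### Tensor products on products of two spaces -/

section Tensor
variable [FiniteDimensional ℝ E₁]

/-- The function `1` on the one-point space. -/
def onePt : 𝓢(EuclideanSpace ℝ (Fin 0), ℂ) where
  toFun _ := 1
  smooth' := contDiff_const
  decay' k n := ⟨_, fun x => by rw [Subsingleton.elim x 0]⟩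

/-- Application of a tempered distribution in the second variable: `x ↦ G (Ψ (x, ·))`. -/
def applySnd (G : 𝓢'(E₂, ℂ)) : 𝓢(E₁ × E₂, ℂ) →L[ℂ] 𝓢(E₁, ℂ) :=
  (compCLMOfContinuousLinearEquiv ℂ
    (ContinuousLinearEquiv.prodUnique ℝ E₁ (EuclideanSpace ℝ (Fin 0))).symm).comp
    (partialCLM ((ContinuousLinearMap.toSpanSingleton ℂ onePt).comp
      (⟨G.toLinearMap, G.continuous⟩ : 𝓢(E₂, ℂ) →L[ℂ] ℂ)))

theorem applySnd_apply (G : 𝓢'(E₂, ℂ)) (Ψ : 𝓢(E₁ × E₂, ℂ)) (x : E₁) :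
    applySnd G Ψ x = G (sliceCLM x Ψ) := by
  change (G (sliceCLM x Ψ) • onePt) _ = _
  change G (sliceCLM x Ψ) * 1 = _
  rw [mul_one]

/-- The tensor product `F ⊗ G` of tempered distributions: `Ψ ↦ F (x ↦ G (Ψ (x, ·)))`. -/
def tensorDist (F : 𝓢'(E₁, ℂ)) (G : 𝓢'(E₂, ℂ)) : 𝓢'(E₁ × E₂, ℂ) :=
  ContinuousLinearMap.toPointwiseConvergenceCLM _ _ _ _
    ((⟨F.toLinearMap, F.continuous⟩ : 𝓢(E₁, ℂ) →L[ℂ] ℂ).comp (applySnd G))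

/-- The tensor product `(x, y) ↦ f x * g y` as a continuous linear function of `f`. -/
def tensorLeft [FiniteDimensional ℝ E₂] (g : 𝓢(E₂, ℂ)) : 𝓢(E₁, ℂ) →L[ℂ] 𝓢(E₁ × E₂, ℂ) :=
  (partialCLM ((ContinuousLinearMap.toSpanSingleton ℂ g).comp
    (⟨(TemperedDistribution.delta (0 : EuclideanSpace ℝ (Fin 0))).toLinearMap,
      (TemperedDistribution.delta (0 : EuclideanSpace ℝ (Fin 0))).continuous⟩ :
      𝓢(EuclideanSpace ℝ (Fin 0), ℂ) →L[ℂ] ℂ))).comp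
  (compCLMOfContinuousLinearEquiv ℂ
    (ContinuousLinearEquiv.prodUnique ℝ E₁ (EuclideanSpace ℝ (Fin 0))))

/-- The tensor product `f ⊗ g` of Schwartz functions. -/
def tensorProd [FiniteDimensional ℝ E₂] (f : 𝓢(E₁, ℂ)) (g : 𝓢(E₂, ℂ)) : 𝓢(E₁ × E₂, ℂ) := tensorLeft g f

theorem tensorProd_apply [FiniteDimensional ℝ E₂] (f : 𝓢(E₁, ℂ)) (g : 𝓢(E₂, ℂ)) (x : E₁) (y : E₂) :
    tensorProd f g (x, y) = f x * g y := rfl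

/-- The tensor product `(x, y) ↦ f x * g y` as a continuous linear function of `g`. -/
def tensorRight [FiniteDimensional ℝ E₂] (f : 𝓢(E₁, ℂ)) : 𝓢(E₂, ℂ) →L[ℂ] 𝓢(E₁ × E₂, ℂ) :=
  (compCLMOfContinuousLinearEquiv ℂ (ContinuousLinearEquiv.prodComm ℝ E₁ E₂)).comp (tensorLeft f)

theorem tensorRight_apply [FiniteDimensional ℝ E₂] (f : 𝓢(E₁, ℂ)) (g : 𝓢(E₂, ℂ)) : tensorRight f g = tensorProd f g := by
  ext ⟨x, y⟩
  rw [tensorProd_apply, mul_comm]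
  rfl

/-- A topological isomorphism of Schwartz spaces acting on the second variable. -/
def partialCLE [FiniteDimensional ℝ E₂] (B : 𝓢(E₂, ℂ) ≃L[ℂ] 𝓢(E₂, ℂ)) : 𝓢(E₁ × E₂, ℂ) ≃L[ℂ] 𝓢(E₁ × E₂, ℂ) :=
  ContinuousLinearEquiv.equivOfInverse (partialCLM (B : 𝓢(E₂, ℂ) →L[ℂ] 𝓢(E₂, ℂ)))
    (partialCLM (B.symm : 𝓢(E₂, ℂ) →L[ℂ] 𝓢(E₂, ℂ)))
    (fun Ψ => by
      ext ⟨x, y⟩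
      have h : sliceCLM x (partialCLM (B : 𝓢(E₂, ℂ) →L[ℂ] 𝓢(E₂, ℂ)) Ψ) = B (sliceCLM x Ψ) := by
        ext y; rfl
      rw [partialCLM_apply, h]
      change B.symm (B (sliceCLM x Ψ)) y = _
      rw [B.symm_apply_apply]; rfl)
    (fun Ψ => by
      ext ⟨x, y⟩
      have h : sliceCLM x (partialCLM (B.symm : 𝓢(E₂, ℂ) →L[ℂ] 𝓢(E₂, ℂ)) Ψ) =
          B.symm (sliceCLM x Ψ) := by
        ext y; rfl
      rw [partialCLM_apply, h]
      change B (B.symm (sliceCLM x Ψ)) y = _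
      rw [B.apply_symm_apply]; rfl)

end Tensor

/-- Linear change of variables `f ↦ f ∘ e` on Schwartz functions. -/
def compCLE (e : E₁ ≃L[ℝ] E₂) : 𝓢(E₂, ℂ) ≃L[ℂ] 𝓢(E₁, ℂ) :=
  ContinuousLinearEquiv.equivOfInverse (compCLMOfContinuousLinearEquiv ℂ e)
    (compCLMOfContinuousLinearEquiv ℂ e.symm)
    (fun f => by ext x; simp) (fun f => by ext x; simp)

/-- Linear change of variables `U ∘ e` for a tempered distribution `U`: if `U` is a function then
`∫ U (e x) φ x dx = |det e|⁻¹ ∫ U y φ (e⁻¹ y) dy`. -/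
def distComp (e : E₁ ≃L[ℝ] E₁) (U : 𝓢'(E₁, ℂ)) : 𝓢'(E₁, ℂ) :=
  ContinuousLinearMap.toPointwiseConvergenceCLM _ _ _ _
    (((|LinearMap.det (e : E₁ →ₗ[ℝ] E₁)|⁻¹ : ℝ) : ℂ) •
      (⟨U.toLinearMap, U.continuous⟩ : 𝓢(E₁, ℂ) →L[ℂ] ℂ).comp
        (compCLMOfContinuousLinearEquiv ℂ e.symm))

theorem distComp_apply (e : E₁ ≃L[ℝ] E₁) (U : 𝓢'(E₁, ℂ)) (φ : 𝓢(E₁, ℂ)) :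
    distComp e U φ = ((|LinearMap.det (e : E₁ →ₗ[ℝ] E₁)|⁻¹ : ℝ) : ℂ) *
      U (compCLMOfContinuousLinearEquiv ℂ e.symm φ) := rfl

/-! ### The cross-Wigner distribution on `ℝ^ι × ℝ^ι = ℝ^{2 ι}` -/

section Wigner
variable {ι : Type} [Fintype ι]

/-- The linear map `(x, t) ↦ (x + t/2, x - t/2)`. -/
def wignerL (E : Type) [NormedAddCommGroup E] [NormedSpace ℝ E] : (E × E) ≃L[ℝ] (E × E) :=
  ContinuousLinearEquiv.equivOfInverse
    (((ContinuousLinearMap.fst ℝ E E) + (2⁻¹ : ℝ) • ContinuousLinearMap.snd ℝ E E).prod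
      ((ContinuousLinearMap.fst ℝ E E) - (2⁻¹ : ℝ) • ContinuousLinearMap.snd ℝ E E))
    (((2⁻¹ : ℝ) • (ContinuousLinearMap.fst ℝ E E + ContinuousLinearMap.snd ℝ E E)).prod
      ((ContinuousLinearMap.fst ℝ E E) - ContinuousLinearMap.snd ℝ E E))
    (fun p => by ext <;> simp <;> module)
    (fun p => by ext <;> simp <;> module)

/-- The map `F ↦ ((x, ξ) ↦ ∫ F (x + t/2, x - t/2) exp (-2 π i t ξ) dt)`, a change of variables
followed by a partial Fourier transform in the second variable. -/
def wignerMap (ι : Type) [Fintype ι] :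
    𝓢(EuclideanSpace ℝ ι × EuclideanSpace ℝ ι, ℂ) ≃L[ℂ] 𝓢(EuclideanSpace ℝ (ι ⊕ ι), ℂ) :=
  ((compCLE (wignerL (EuclideanSpace ℝ ι))).trans
    (partialCLE (FourierTransform.fourierCLE ℂ 𝓢(EuclideanSpace ℝ ι, ℂ)))).trans
    (compCLE EuclideanSpace.sumEquivProd)

open Real in
theorem wignerMap_apply (F : 𝓢(EuclideanSpace ℝ ι × EuclideanSpace ℝ ι, ℂ))
    (z : EuclideanSpace ℝ (ι ⊕ ι)) :
    wignerMap ι F z = ∫ t : EuclideanSpace ℝ ι,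
      F ((EuclideanSpace.sumEquivProd z).1 + (2⁻¹ : ℝ) • t,
        (EuclideanSpace.sumEquivProd z).1 - (2⁻¹ : ℝ) • t) *
      Complex.exp (-2 * π * Complex.I * (inner ℝ t (EuclideanSpace.sumEquivProd z).2 : ℝ)) := by
  have h1 : wignerMap ι F z =
      (𝓕 (sliceCLM (EuclideanSpace.sumEquivProd z).1 (compCLE (wignerL (EuclideanSpace ℝ ι)) F)) :
        𝓢(EuclideanSpace ℝ ι, ℂ)) (EuclideanSpace.sumEquivProd z).2 := rfl
  rw [h1, fourier_coe, Real.fourier_eq']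
  refine integral_congr_ae (Filter.Eventually.of_forall fun t => ?_)
  have h2 : (sliceCLM (EuclideanSpace.sumEquivProd z).1
      (compCLE (wignerL (EuclideanSpace ℝ ι)) F)) t =
      F ((EuclideanSpace.sumEquivProd z).1 + (2⁻¹ : ℝ) • t,
        (EuclideanSpace.sumEquivProd z).1 - (2⁻¹ : ℝ) • t) := rfl
  simp only [h2, smul_eq_mul]
  rw [mul_comm]
  congr 2
  push_cast
  ring

/-- The cross-Wigner distribution `W (f, g)` of two Schwartz functions. -/
def crossWigner (f g : 𝓢(EuclideanSpace ℝ ι, ℂ)) : 𝓢(EuclideanSpace ℝ (ι ⊕ ι), ℂ) :=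
  wignerMap ι (tensorProd f (conjS g))

open Real in
theorem crossWigner_apply (f g : 𝓢(EuclideanSpace ℝ ι, ℂ)) (x ξ : EuclideanSpace ℝ ι) :
    crossWigner f g (EuclideanSpace.sumEquivProd.symm (x, ξ)) =
      ∫ t : EuclideanSpace ℝ ι, f (x + (2⁻¹ : ℝ) • t) * conj (g (x - (2⁻¹ : ℝ) • t)) *
        Complex.exp (-2 * π * Complex.I * (inner ℝ t ξ : ℝ)) := by
  rw [crossWigner, wignerMap_apply, ContinuousLinearEquiv.apply_symm_apply]
  simp only [tensorProd_apply, conjS_apply]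

/-- The cross-Wigner distribution `W (F, G)` of two tempered distributions: the extension of
`wignerMap` to tempered distributions, applied to `F ⊗ conj G`. -/
def crossWignerDist (F G : 𝓢'(EuclideanSpace ℝ ι, ℂ)) : 𝓢'(EuclideanSpace ℝ (ι ⊕ ι), ℂ) :=
  extendUnitary (wignerMap ι) (tensorDist F (conjDist G))

end Wigner

/-! ### Weyl operators and kernels -/

/-- The Hörmander class `S^0_{0,0}`: smooth functions all of whose derivatives are bounded. -/
def IsSymbol {E : Type} [NormedAddCommGroup E] [NormedSpace ℝ E] (σ : E → ℂ) : Prop :=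
  ContDiff ℝ ∞ σ ∧ ∀ n : ℕ, ∃ C : ℝ, ∀ x, ‖iteratedFDeriv ℝ n σ x‖ ≤ C

theorem IsSymbol.hasTemperateGrowth {E : Type} [NormedAddCommGroup E] [NormedSpace ℝ E]
    {σ : E → ℂ} (h : IsSymbol σ) : σ.HasTemperateGrowth :=
  ⟨h.1, fun n => by
    obtain ⟨C, hC⟩ := h.2 n
    exact ⟨0, C, fun x => by simpa using hC x⟩⟩

section Operators
variable {ι κ : Type} [Fintype ι] [Fintype κ]

/-- The Weyl quantization of `σ ∈ 𝓢'(ℝ^{2n})`: the operator `𝓢(ℝ^n) → 𝓢'(ℝ^n)` with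
`⟨Op σ f, g⟩ = ⟨σ, W (g, f)⟩` (see `pair_weylOp`). As a linear functional of
`φ = conj g` this is `φ ↦ σ (W (f, conj φ))`, and `W (f, conj φ)` is `wignerMap` of `f ⊗ φ`. -/
def weylOp (σ : 𝓢'(EuclideanSpace ℝ (ι ⊕ ι), ℂ)) :
    𝓢(EuclideanSpace ℝ ι, ℂ) →L[ℂ] 𝓢'(EuclideanSpace ℝ ι, ℂ) where
  toFun f := ContinuousLinearMap.toPointwiseConvergenceCLM _ _ _ _
    ((⟨σ.toLinearMap, σ.continuous⟩ : 𝓢(EuclideanSpace ℝ (ι ⊕ ι), ℂ) →L[ℂ] ℂ).comp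
      ((wignerMap ι : _ →L[ℂ] 𝓢(EuclideanSpace ℝ (ι ⊕ ι), ℂ)).comp (tensorRight f)))
  map_add' f g := by
    ext φ
    change σ (wignerMap ι (tensorRight (f + g) φ)) = σ (wignerMap ι (tensorRight f φ)) +
      σ (wignerMap ι (tensorRight g φ))
    simp only [tensorRight_apply, tensorProd, map_add]
  map_smul' c f := by
    ext φ
    change σ (wignerMap ι (tensorRight (c • f) φ)) = c • σ (wignerMap ι (tensorRight f φ))
    simp only [tensorRight_apply, tensorProd, map_smul]
  cont := PointwiseConvergenceCLM.continuous_of_continuous_eval fun φ => by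
    change Continuous fun f => σ (wignerMap ι (tensorRight f φ))
    simp only [tensorRight_apply]
    exact σ.continuous.comp ((wignerMap ι).continuous.comp (tensorLeft φ).continuous)

theorem conjS_crossWigner (f g : 𝓢(EuclideanSpace ℝ ι, ℂ)) :
    conjS (crossWigner f g) = crossWigner g f := by
  ext z
  simp only [conjS_apply, crossWigner, wignerMap_apply, tensorProd_apply, ← integral_conj]
  rw [← integral_neg_eq_self]
  refine integral_congr_ae (Filter.Eventually.of_forall fun t => ?_)
  simp only [map_mul, Complex.conj_conj, ← Complex.exp_conj, smul_neg, sub_neg_eq_add,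
    ← sub_eq_add_neg, inner_neg_left, Complex.conj_ofReal, Complex.conj_I, map_neg]
  rw [mul_comm (conj (f _))]
  congr 2
  push_cast
  simp [Complex.conj_ofNat]

theorem pair_weylOp (σ : 𝓢'(EuclideanSpace ℝ (ι ⊕ ι), ℂ)) (f g : 𝓢(EuclideanSpace ℝ ι, ℂ)) :
    pair (weylOp σ f) g = pair σ (crossWigner g f) := by
  change σ (wignerMap ι (tensorRight f (conjS g))) = σ (conjS (crossWigner g f))
  rw [conjS_crossWigner, tensorRight_apply]
  rfl

/-- The tensor product `f ⊗ g` of Schwartz functions on `ℝ^ι` and `ℝ^κ`, as a function on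
`ℝ^{ι + κ}`. -/
def tensor (f : 𝓢(EuclideanSpace ℝ ι, ℂ)) (g : 𝓢(EuclideanSpace ℝ κ, ℂ)) :
    𝓢(EuclideanSpace ℝ (ι ⊕ κ), ℂ) :=
  compCLE EuclideanSpace.sumEquivProd (tensorProd f g)

theorem tensor_apply (f : 𝓢(EuclideanSpace ℝ ι, ℂ)) (g : 𝓢(EuclideanSpace ℝ κ, ℂ))
    (z : EuclideanSpace ℝ (ι ⊕ κ)) :
    tensor f g z = f (EuclideanSpace.sumEquivProd z).1 * g (EuclideanSpace.sumEquivProd z).2 := rfl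

/-- `h` is the (Schwartz) kernel of `A : 𝓢(ℝ^ι) → 𝓢'(ℝ^ι)`: `⟨A f, g⟩ = ⟨h, g ⊗ conj f⟩`. -/
def IsKernel (A : 𝓢(EuclideanSpace ℝ ι, ℂ) →L[ℂ] 𝓢'(EuclideanSpace ℝ ι, ℂ))
    (h : 𝓢'(EuclideanSpace ℝ (ι ⊕ ι), ℂ)) : Prop :=
  ∀ f g, pair (A f) g = pair h (tensor g (conjS f))

/-- `k` is the Wigner kernel of `T`:
`⟨W (T f, T g), W (u, v)⟩ = ⟨k, W (u, v) ⊗ conj W (f, g)⟩` for all `f, g, u, v`. -/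
def IsWignerKernel (T : 𝓢(EuclideanSpace ℝ ι, ℂ) →L[ℂ] 𝓢'(EuclideanSpace ℝ ι, ℂ))
    (k : 𝓢'(EuclideanSpace ℝ ((ι ⊕ ι) ⊕ (ι ⊕ ι)), ℂ)) : Prop :=
  ∀ f g u v, pair (crossWignerDist (T f) (T g)) (crossWigner u v) =
    pair k (tensor (crossWigner u v) (conjS (crossWigner f g)))

/-- The adjoint `T*` of `T : 𝓢(ℝ^ι) → 𝓢'(ℝ^ι)`: `⟨T* f, g⟩ = conj ⟨T g, f⟩`
(see `pair_adjointOp`). -/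
def adjointOp (T : 𝓢(EuclideanSpace ℝ ι, ℂ) →L[ℂ] 𝓢'(EuclideanSpace ℝ ι, ℂ)) :
    𝓢(EuclideanSpace ℝ ι, ℂ) →L[ℂ] 𝓢'(EuclideanSpace ℝ ι, ℂ) where
  toFun f := ContinuousLinearMap.toPointwiseConvergenceCLM _ _ _ _
    { toFun := fun φ => conj (T (conjS φ) (conjS f))
      map_add' := fun φ ψ => by
        rw [map_add, map_add]
        exact map_add conj (T (conjS φ) (conjS f)) (T (conjS ψ) (conjS f))
      map_smul' := fun c φ => by
        rw [conjS_smul, map_smul]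
        exact (map_mul conj (conj c) (T (conjS φ) (conjS f))).trans (by simp)
      cont := Complex.continuous_conj.comp
        ((PointwiseConvergenceCLM.evalCLM (RingHom.id ℂ) ℂ (conjS f)).continuous.comp
          (T.continuous.comp conjS.continuous)) }
  map_add' f g := by
    ext φ
    change conj (T (conjS φ) (conjS (f + g))) =
      conj (T (conjS φ) (conjS f)) + conj (T (conjS φ) (conjS g))
    rw [map_add, map_add, map_add]
  map_smul' c f := by
    ext φ
    change conj (T (conjS φ) (conjS (c • f))) = c * conj (T (conjS φ) (conjS f))
    rw [conjS_smul, map_smul]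
    simp
  cont := PointwiseConvergenceCLM.continuous_of_continuous_eval fun φ =>
    Complex.continuous_conj.comp ((T (conjS φ)).continuous.comp conjS.continuous)

theorem pair_adjointOp (T : 𝓢(EuclideanSpace ℝ ι, ℂ) →L[ℂ] 𝓢'(EuclideanSpace ℝ ι, ℂ))
    (f g : 𝓢(EuclideanSpace ℝ ι, ℂ)) :
    pair (adjointOp T f) g = conj (pair (T g) f) := by
  change conj (T (conjS (conjS g)) (conjS f)) = _
  rw [conjS_conjS]; rfl

/-- The swap `(z, w) ↦ (w, z)` of `ℝ^{κ + κ}`. -/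
def swapE (κ : Type) [Fintype κ] :
    EuclideanSpace ℝ (κ ⊕ κ) ≃L[ℝ] EuclideanSpace ℝ (κ ⊕ κ) :=
  (EuclideanSpace.sumEquivProd.trans (ContinuousLinearEquiv.prodComm ℝ _ _)).trans
    EuclideanSpace.sumEquivProd.symm

/-- The map `(z, w) ↦ (z, e w)` of `ℝ^{κ + κ}`. -/
def sndE (e : EuclideanSpace ℝ κ ≃L[ℝ] EuclideanSpace ℝ κ) :
    EuclideanSpace ℝ (κ ⊕ κ) ≃L[ℝ] EuclideanSpace ℝ (κ ⊕ κ) :=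
  (EuclideanSpace.sumEquivProd.trans ((ContinuousLinearEquiv.refl ℝ _).prodCongr e)).trans
    EuclideanSpace.sumEquivProd.symm

/-- The action of a symplectic matrix on phase space `ℝ^{2 ι}`. -/
def sympE [DecidableEq ι] (S : Matrix.symplecticGroup ι ℝ) :
    EuclideanSpace ℝ (ι ⊕ ι) ≃L[ℝ] EuclideanSpace ℝ (ι ⊕ ι) :=
  ContinuousLinearEquiv.equivOfInverse
    (Matrix.toEuclideanCLM (𝕜 := ℝ) (S : Matrix (ι ⊕ ι) (ι ⊕ ι) ℝ))
    (Matrix.toEuclideanCLM (𝕜 := ℝ) ((S⁻¹ : Matrix.symplecticGroup ι ℝ) :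
      Matrix (ι ⊕ ι) (ι ⊕ ι) ℝ))
    (fun z => by
      change ((Matrix.toEuclideanCLM (𝕜 := ℝ) ((S⁻¹ : Matrix.symplecticGroup ι ℝ) : Matrix (ι ⊕ ι) (ι ⊕ ι) ℝ) *
        Matrix.toEuclideanCLM (𝕜 := ℝ) (S : Matrix (ι ⊕ ι) (ι ⊕ ι) ℝ) :
        EuclideanSpace ℝ (ι ⊕ ι) →L[ℝ] EuclideanSpace ℝ (ι ⊕ ι))) z = z
      rw [← map_mul, ← Submonoid.coe_mul, inv_mul_cancel]
      simp)
    (fun z => by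
      change ((Matrix.toEuclideanCLM (𝕜 := ℝ) (S : Matrix (ι ⊕ ι) (ι ⊕ ι) ℝ) *
        Matrix.toEuclideanCLM (𝕜 := ℝ) ((S⁻¹ : Matrix.symplecticGroup ι ℝ) : Matrix (ι ⊕ ι) (ι ⊕ ι) ℝ) :
        EuclideanSpace ℝ (ι ⊕ ι) →L[ℝ] EuclideanSpace ℝ (ι ⊕ ι))) z = z
      rw [← map_mul, ← Submonoid.coe_mul, mul_inv_cancel]
      simp)

/-- The class `FIO(S)`: the Wigner kernel of `T` is `k (z, w) = h (z, S w)`, where `h` is the kernel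
of a (Weyl) pseudodifferential operator with symbol in `S^0_{0,0}(ℝ^{4d})`. -/
def IsFIO [DecidableEq ι] (S : Matrix.symplecticGroup ι ℝ)
    (T : 𝓢(EuclideanSpace ℝ ι, ℂ) →L[ℂ] 𝓢'(EuclideanSpace ℝ ι, ℂ)) : Prop :=
  ∃ k, IsWignerKernel T k ∧
    ∃ (σ : EuclideanSpace ℝ ((ι ⊕ ι) ⊕ (ι ⊕ ι)) → ℂ) (hσ : IsSymbol σ)
      (h : 𝓢'(EuclideanSpace ℝ ((ι ⊕ ι) ⊕ (ι ⊕ ι)), ℂ)),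
      IsKernel (weylOp (hσ.hasTemperateGrowth.toTemperedDistribution volume)) h ∧
      k = distComp (sndE (sympE S)) h

/-- The restriction to `𝓢(ℝ^ι)` of the bounded operator `A` of `L²(ℝ^ι)` is `T`. -/
def IsRestriction (A : Lp ℂ 2 (volume : Measure (EuclideanSpace ℝ ι)) →L[ℂ]
      Lp ℂ 2 (volume : Measure (EuclideanSpace ℝ ι)))
    (T : 𝓢(EuclideanSpace ℝ ι, ℂ) →L[ℂ] 𝓢'(EuclideanSpace ℝ ι, ℂ)) : Prop :=
  ∀ f, T f = Lp.toTemperedDistribution (A (f.toLp 2))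

end Operators

end

end WignerFIO

open WignerFIO

open SchwartzMap MeasureTheory
open scoped ContDiff ComplexConjugate FourierTransform
open WignerFIO

/-! ### Pairings, tensor products and the Moyal identity -/

section
variable {E E₁ E₂ : Type} [NormedAddCommGroup E] [NormedSpace ℝ E]
  [NormedAddCommGroup E₁] [NormedSpace ℝ E₁] [FiniteDimensional ℝ E₁]
  [NormedAddCommGroup E₂] [NormedSpace ℝ E₂] [FiniteDimensional ℝ E₂]
variable {ι κ : Type} [Fintype ι] [Fintype κ]

/-! By the Moyal identity, ⟨W(Tf,Tg), W(u,v)⟩ = ⟨Tf,u⟩ · conj ⟨Tg,v⟩, so being a Wigner kernel of T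
is a statement about the matrix coefficients of T alone. For T* these become conj ⟨Tu,f⟩ · ⟨Tv,g⟩,
which is the same expression for T with the roles of (f,g) and (u,v) exchanged and both pairs
reversed. Since conj W(f,g) = W(g,f), the reversal is absorbed by the conjugations, and what remains
is the exchange of z and w in k (`isWignerKernel_adjointOp`). No uniqueness of the kernel is needed.

For the FIO property, write k(z,w) = h(z,Sw). The kernel of T* is then k(w,z) = h(w,Sz), which
equals h'(z,S⁻¹w) with h'(z,w) = h(Sw,Sz). If h is the kernel of a Weyl operator, h' is the kernel
of its transpose conjugated by S. Transposition turns the symbol σ(x,ξ) into σ(x,-ξ), and a linear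
change of variables acts on symbols by the induced map of phase space; together the symbol of h' is
σ(Sx, -S⁻ᵀξ) (`isKernel_weylOp_comp`). The class S⁰₀,₀ is stable under invertible linear maps, so
this is again a symbol. Of the symplectic condition only det S = 1 and the stability of the group
under transposition and inversion matter; the former removes all Jacobian factors.

The statement about L² holds because the distributional pairing of an L² function with a Schwartz
function is the L² inner product, so both adjoints satisfy the same identity on Schwartz functions.
-/

theorem tensorDist_tensorProd (F : 𝓢'(E₁, ℂ)) (G : 𝓢'(E₂, ℂ)) (f : 𝓢(E₁, ℂ)) (g : 𝓢(E₂, ℂ)) :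
    tensorDist F G (tensorProd f g) = F f * G g := by
  have h : applySnd G (tensorProd f g) = G g • f := by
    ext x
    have h' : sliceCLM x (tensorProd f g) = f x • g := by
      ext y
      rfl
    rw [applySnd_apply, h', map_smul, smul_apply, smul_eq_mul, smul_eq_mul, mul_comm]
  change F (applySnd G (tensorProd f g)) = _
  rw [h, map_smul, smul_eq_mul, mul_comm]

theorem conjS_tensorProd (f : 𝓢(E₁, ℂ)) (g : 𝓢(E₂, ℂ)) :
    conjS (tensorProd f g) = tensorProd (conjS f) (conjS g) := by
  ext ⟨x, y⟩
  simp [tensorProd_apply]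

theorem conjS_tensor (f : 𝓢(EuclideanSpace ℝ ι, ℂ)) (g : 𝓢(EuclideanSpace ℝ κ, ℂ)) :
    conjS (tensor f g) = tensor (conjS f) (conjS g) := by
  ext z
  simp [tensor_apply]

/-- The Moyal identity for tempered distributions. -/
theorem pair_crossWignerDist (F G : 𝓢'(EuclideanSpace ℝ ι, ℂ)) (u v : 𝓢(EuclideanSpace ℝ ι, ℂ)) :
    pair (crossWignerDist F G) (crossWigner u v) = pair F u * conj (pair G v) := by
  -- The extension to distributions is defined by moving the inverse map to the test function, so it
  -- cancels against the `wignerMap` inside W(u,v) and only u ⊗ conj v is left.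
  rw [crossWignerDist, pair_extendUnitary, crossWigner, ContinuousLinearEquiv.symm_apply_apply,
    pair, conjS_tensorProd, conjS_conjS, tensorDist_tensorProd, conjDist_apply]
  rfl

/-! ### Linear changes of variables of determinant ±1 -/

theorem distComp_apply_of_abs_det_eq_one {e : E ≃L[ℝ] E}
    (he : |LinearMap.det (e : E →ₗ[ℝ] E)| = 1) (U : 𝓢'(E, ℂ)) (φ : 𝓢(E, ℂ)) :
    distComp e U φ = U (compCLMOfContinuousLinearEquiv ℂ e.symm φ) := by
  rw [distComp_apply, he]
  simp

theorem compCLM_swapE_symm_tensor (f g : 𝓢(EuclideanSpace ℝ κ, ℂ)) :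
    compCLMOfContinuousLinearEquiv ℂ (swapE κ).symm (tensor f g) = tensor g f := by
  ext z
  exact mul_comm _ _

theorem compCLM_sndE_symm_tensor (e : EuclideanSpace ℝ κ ≃L[ℝ] EuclideanSpace ℝ κ)
    (f g : 𝓢(EuclideanSpace ℝ κ, ℂ)) :
    compCLMOfContinuousLinearEquiv ℂ (sndE e).symm (tensor f g) =
      tensor f (compCLMOfContinuousLinearEquiv ℂ e.symm g) := by
  ext z
  simp [tensor_apply, sndE]

/-- The swap is an involution, so its determinant squares to one; its sign is irrelevant for
distributions. -/
theorem abs_det_swapE (κ : Type) [Fintype κ] :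
    |LinearMap.det (swapE κ : EuclideanSpace ℝ (κ ⊕ κ) →ₗ[ℝ] EuclideanSpace ℝ (κ ⊕ κ))| = 1 := by
  have h : (swapE κ : EuclideanSpace ℝ (κ ⊕ κ) →ₗ[ℝ] EuclideanSpace ℝ (κ ⊕ κ)) ∘ₗ
      (swapE κ : EuclideanSpace ℝ (κ ⊕ κ) →ₗ[ℝ] EuclideanSpace ℝ (κ ⊕ κ)) = LinearMap.id := by
    ext1 x
    exact EuclideanSpace.sumEquivProd.symm_apply_apply x
  have h2 := congrArg LinearMap.det h
  rw [LinearMap.det_comp, LinearMap.det_id] at h2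
  rcases mul_self_eq_one_iff.1 h2 with h | h <;> rw [h] <;> simp

/-- Up to conjugation by the identification of the sum with the product, the map is block diagonal.
This serves both (z,w) ↦ (z,Sw) and the phase space map acting on symbols. -/
theorem abs_det_conj_prodCongr (e e' : EuclideanSpace ℝ κ ≃L[ℝ] EuclideanSpace ℝ κ) :
    |LinearMap.det (((EuclideanSpace.sumEquivProd.trans (e.prodCongr e')).trans
      EuclideanSpace.sumEquivProd.symm : EuclideanSpace ℝ (κ ⊕ κ) ≃L[ℝ] EuclideanSpace ℝ (κ ⊕ κ)) :
      EuclideanSpace ℝ (κ ⊕ κ) →ₗ[ℝ] EuclideanSpace ℝ (κ ⊕ κ))| =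
    |LinearMap.det (e : EuclideanSpace ℝ κ →ₗ[ℝ] EuclideanSpace ℝ κ)| *
      |LinearMap.det (e' : EuclideanSpace ℝ κ →ₗ[ℝ] EuclideanSpace ℝ κ)| := by
  rw [← abs_mul, ← LinearMap.det_prodMap, ← LinearMap.det_conj _
    (EuclideanSpace.sumEquivProd (𝕜 := ℝ) (ι := κ) (κ := κ)).symm.toLinearEquiv]
  rfl

theorem abs_det_sndE {e : EuclideanSpace ℝ κ ≃L[ℝ] EuclideanSpace ℝ κ}
    (he : |LinearMap.det (e : EuclideanSpace ℝ κ →ₗ[ℝ] EuclideanSpace ℝ κ)| = 1) :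
    |LinearMap.det (sndE e : EuclideanSpace ℝ (κ ⊕ κ) →ₗ[ℝ] EuclideanSpace ℝ (κ ⊕ κ))| = 1 := by
  rw [sndE, abs_det_conj_prodCongr, he, mul_one]
  exact (congrArg abs LinearMap.det_id).trans abs_one

theorem measurePreserving_of_abs_det_eq_one {E : Type} [NormedAddCommGroup E]
    [InnerProductSpace ℝ E] [FiniteDimensional ℝ E] [MeasurableSpace E] [BorelSpace E]
    {e : E ≃L[ℝ] E} (he : |LinearMap.det (e : E →ₗ[ℝ] E)| = 1) :
    MeasurePreserving e (volume : Measure E) volume := by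
  refine ⟨e.continuous.measurable, ?_⟩
  have h0 : LinearMap.det (e : E →ₗ[ℝ] E) ≠ 0 := fun h => by simp [h] at he
  have := Measure.map_linearMap_addHaar_eq_smul_addHaar (volume : Measure E) h0
  rw [abs_inv, he] at this
  simpa using this

theorem integral_comp_of_abs_det_eq_one {E : Type} [NormedAddCommGroup E]
    [InnerProductSpace ℝ E] [FiniteDimensional ℝ E] [MeasurableSpace E] [BorelSpace E]
    {e : E ≃L[ℝ] E} (he : |LinearMap.det (e : E →ₗ[ℝ] E)| = 1) (g : E → ℂ) :
    ∫ x, g (e x) = ∫ x, g x :=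
  (measurePreserving_of_abs_det_eq_one he).integral_comp
    e.toHomeomorph.measurableEmbedding g

/-- The n-th derivative of σ ∘ e is that of σ with e inserted in each of the n slots, which costs at
most a factor ‖e‖ⁿ. -/
theorem WignerFIO.IsSymbol.comp_equiv {F : Type} [NormedAddCommGroup F] [NormedSpace ℝ F]
    {σ : F → ℂ} (hσ : IsSymbol σ) (e : E ≃L[ℝ] F) : IsSymbol (σ ∘ e) := by
  refine ⟨hσ.1.comp e.contDiff, fun n => ?_⟩
  obtain ⟨C, hC⟩ := hσ.2 n
  refine ⟨C * ∏ _i : Fin n, ‖(e : E →L[ℝ] F)‖, fun x => ?_⟩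
  have := (e : E →L[ℝ] F).iteratedFDeriv_comp_right hσ.1 x (i := n) (by exact_mod_cast le_top)
  rw [show σ ∘ e = σ ∘ (e : E →L[ℝ] F) from rfl, this]
  refine (ContinuousMultilinearMap.norm_compContinuousLinearMap_le _ _).trans ?_
  gcongr
  exact hC _

/-- Substitute t ↦ e t in the Wigner integral: the compositions with e⁻¹ cancel, and the phase e t ·
ξ becomes t · e'ξ, where e' is the transpose of e. Conjugating f and g amounts to conjugating the
integral and reversing the sign of the frequency. -/
theorem crossWigner_conjS_comp {e e' : EuclideanSpace ℝ ι ≃L[ℝ] EuclideanSpace ℝ ι}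
    (he : |LinearMap.det (e : EuclideanSpace ℝ ι →ₗ[ℝ] EuclideanSpace ℝ ι)| = 1)
    (hee' : ∀ t ξ, inner ℝ (e t) ξ = inner ℝ t (e' ξ)) (f g : 𝓢(EuclideanSpace ℝ ι, ℂ))
    (x ξ : EuclideanSpace ℝ ι) :
    crossWigner (compCLMOfContinuousLinearEquiv ℂ e.symm (conjS f))
      (compCLMOfContinuousLinearEquiv ℂ e.symm (conjS g))
      (EuclideanSpace.sumEquivProd.symm (e x, ξ)) =
    conj (crossWigner f g (EuclideanSpace.sumEquivProd.symm (x, -e' ξ))) := by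
  rw [crossWigner_apply, crossWigner_apply, ← integral_conj, ← integral_comp_of_abs_det_eq_one he]
  refine integral_congr_ae (Filter.Eventually.of_forall fun t => ?_)
  simp only [compCLMOfContinuousLinearEquiv_apply, Function.comp_apply, conjS_apply, map_mul,
    ← Complex.exp_conj, hee', inner_neg_right, map_add, map_sub, map_smul,
    ContinuousLinearEquiv.symm_apply_apply, Complex.conj_ofReal, Complex.conj_I, map_neg]
  congr 2
  push_cast
  simp [Complex.conj_ofNat]

/-! ### The Wigner kernel of the adjoint and the Hilbert space adjoint -/

theorem isWignerKernel_adjointOp {T : 𝓢(EuclideanSpace ℝ ι, ℂ) →L[ℂ] 𝓢'(EuclideanSpace ℝ ι, ℂ)}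
    {k : 𝓢'(EuclideanSpace ℝ ((ι ⊕ ι) ⊕ (ι ⊕ ι)), ℂ)} (hk : IsWignerKernel T k) :
    IsWignerKernel (adjointOp T) (distComp (swapE (ι ⊕ ι)) k) := by
  intro f g u v
  -- Moyal for T* yields conj ⟨Tu,f⟩ · ⟨Tv,g⟩. The conjugated factor has to come from the second
  -- argument of the Wigner distribution, which forces the order v, u and g, f.
  have h := hk v u g f
  rw [pair_crossWignerDist] at h
  rw [pair_crossWignerDist, pair_adjointOp, pair_adjointOp, Complex.conj_conj, mul_comm, h,
    pair, pair, distComp_apply_of_abs_det_eq_one (abs_det_swapE _), conjS_tensor, conjS_tensor,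
    compCLM_swapE_symm_tensor, conjS_conjS, conjS_conjS, conjS_crossWigner, conjS_crossWigner]

/-- The distribution attached to a integrates against a without conjugation, so testing on conj f
gives the L² inner product, conjugate-linear in its first slot. -/
theorem toTemperedDistribution_conjS (a : Lp ℂ 2 (volume : Measure (EuclideanSpace ℝ ι)))
    (f : 𝓢(EuclideanSpace ℝ ι, ℂ)) :
    Lp.toTemperedDistribution a (conjS f) = inner ℂ (f.toLp 2) a := by
  rw [Lp.toTemperedDistribution_apply, L2.inner_def]
  refine integral_congr_ae ?_
  filter_upwards [f.coeFn_toLp 2 volume] with x hx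
  rw [hx, RCLike.inner_apply, mul_comm]
  rfl

theorem conj_inner_eq_inner_adjoint {H : Type*} [NormedAddCommGroup H] [InnerProductSpace ℂ H]
    [CompleteSpace H] (A : H →L[ℂ] H) (x y : H) :
    conj (inner ℂ x (A y)) = inner ℂ y (ContinuousLinearMap.adjoint A x) := by
  rw [inner_conj_symm, ContinuousLinearMap.adjoint_inner_right]

theorem toTemperedDistribution_adjoint
    (A : Lp ℂ 2 (volume : Measure (EuclideanSpace ℝ ι)) →L[ℂ]
      Lp ℂ 2 (volume : Measure (EuclideanSpace ℝ ι))) (f φ : 𝓢(EuclideanSpace ℝ ι, ℂ)) :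
    Lp.toTemperedDistribution (ContinuousLinearMap.adjoint A (f.toLp 2)) (conjS φ) =
      conj (Lp.toTemperedDistribution (A (φ.toLp 2)) (conjS f)) := by
  rw [toTemperedDistribution_conjS, toTemperedDistribution_conjS, conj_inner_eq_inner_adjoint]

theorem isRestriction_adjointOp
    {T : 𝓢(EuclideanSpace ℝ ι, ℂ) →L[ℂ] 𝓢'(EuclideanSpace ℝ ι, ℂ)}
    {A : Lp ℂ 2 (volume : Measure (EuclideanSpace ℝ ι)) →L[ℂ]
      Lp ℂ 2 (volume : Measure (EuclideanSpace ℝ ι))} (h : IsRestriction A T) :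
    IsRestriction (ContinuousLinearMap.adjoint A) (adjointOp T) := by
  intro f
  ext φ
  -- The adjoint identity is stated for conjugated test functions; taking `conjS φ` makes the two
  -- conjugations cancel.
  have h1 := toTemperedDistribution_adjoint A f (conjS φ)
  rw [conjS_conjS, ← h] at h1
  exact h1.symm

/-! ### Transposition and linear conjugation of Weyl operators -/

/-- Unfolding both pairings and using conj W(g,f) = W(f,g) leaves a bilinear identity in f and conj
g, in which the transposition is easy to follow. -/
theorem isKernel_weylOp_iff {σ : EuclideanSpace ℝ (κ ⊕ κ) → ℂ} (hσ : IsSymbol σ)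
    {h : 𝓢'(EuclideanSpace ℝ (κ ⊕ κ), ℂ)} :
    IsKernel (weylOp (hσ.hasTemperateGrowth.toTemperedDistribution volume)) h ↔
      ∀ f g, ∫ z, crossWigner f g z * σ z = h (tensor (conjS g) f) := by
  have : ∀ f g, (pair (weylOp (hσ.hasTemperateGrowth.toTemperedDistribution volume) f) g =
      pair h (tensor g (conjS f))) ↔
      (∫ z, crossWigner f g z * σ z = h (tensor (conjS g) f)) := by
    intro f g
    rw [pair_weylOp, pair, pair, conjS_tensor, conjS_conjS, conjS_crossWigner]
    rfl
  exact forall₂_congr this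

/-- Conjugating a Weyl operator by a volume-preserving linear map and transposing it composes its
symbol with the induced map of phase space. -/
theorem isKernel_weylOp_comp {e e' : EuclideanSpace ℝ κ ≃L[ℝ] EuclideanSpace ℝ κ}
    (he : |LinearMap.det (e : EuclideanSpace ℝ κ →ₗ[ℝ] EuclideanSpace ℝ κ)| = 1)
    (he' : |LinearMap.det (e' : EuclideanSpace ℝ κ →ₗ[ℝ] EuclideanSpace ℝ κ)| = 1)
    (hee' : ∀ t ξ, inner ℝ (e t) ξ = inner ℝ t (e' ξ))
    {σ : EuclideanSpace ℝ (κ ⊕ κ) → ℂ} (hσ : IsSymbol σ)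
    {h : 𝓢'(EuclideanSpace ℝ (κ ⊕ κ), ℂ)}
    (hh : IsKernel (weylOp (hσ.hasTemperateGrowth.toTemperedDistribution volume)) h) :
    ∃ (σ' : EuclideanSpace ℝ (κ ⊕ κ) → ℂ) (hσ' : IsSymbol σ'),
      IsKernel (weylOp (hσ'.hasTemperateGrowth.toTemperedDistribution volume))
        (distComp (sndE e) (distComp (swapE κ) (distComp (sndE e) h))) := by
  -- M(x,ξ) = (e x, -e'⁻¹ξ): the symplectic lift of e, composed with the frequency reflection due to
  -- transposition.
  set M : EuclideanSpace ℝ (κ ⊕ κ) ≃L[ℝ] EuclideanSpace ℝ (κ ⊕ κ) :=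
    (EuclideanSpace.sumEquivProd.trans
      (e.prodCongr (e'.symm.trans (ContinuousLinearEquiv.neg ℝ)))).trans
      EuclideanSpace.sumEquivProd.symm with hMdef
  have hneg : ∀ ξ, -e' (-(e'.symm ξ)) = ξ := fun ξ => by simp
  have hneg' : |LinearMap.det ((e'.symm.trans (ContinuousLinearEquiv.neg ℝ) :
      EuclideanSpace ℝ κ ≃L[ℝ] EuclideanSpace ℝ κ) :
      EuclideanSpace ℝ κ →ₗ[ℝ] EuclideanSpace ℝ κ)| = 1 := by
    -- Composing -e'⁻¹ with e' gives -id, so its determinant is ±1 without computing that of the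
    -- inverse.
    have h1 : ((e'.symm.trans (ContinuousLinearEquiv.neg ℝ) :
      EuclideanSpace ℝ κ ≃L[ℝ] EuclideanSpace ℝ κ) :
      EuclideanSpace ℝ κ →ₗ[ℝ] EuclideanSpace ℝ κ) ∘ₗ
      (e' : EuclideanSpace ℝ κ →ₗ[ℝ] EuclideanSpace ℝ κ) =
        (-1 : ℝ) • (LinearMap.id : EuclideanSpace ℝ κ →ₗ[ℝ] EuclideanSpace ℝ κ) := by
      ext1 x
      simp
    have h2 := congrArg (fun L => |LinearMap.det L|) h1
    simp only [LinearMap.det_comp, abs_mul, he', mul_one, LinearMap.det_smul, abs_pow, abs_neg,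
      abs_one, one_pow, LinearMap.det_id] at h2
    exact h2
  have hM : |LinearMap.det (M : EuclideanSpace ℝ (κ ⊕ κ) →ₗ[ℝ] EuclideanSpace ℝ (κ ⊕ κ))| = 1 := by
    rw [hMdef, abs_det_conj_prodCongr, he, hneg', mul_one]
  have hs := abs_det_sndE he
  refine ⟨σ ∘ M, hσ.comp_equiv M, (isKernel_weylOp_iff (hσ.comp_equiv M)).2 fun f g => ?_⟩
  have hW : ∀ z, crossWigner (compCLMOfContinuousLinearEquiv ℂ e.symm (conjS g))
      (compCLMOfContinuousLinearEquiv ℂ e.symm (conjS f)) (M z) = crossWigner f g z := by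
    intro z
    refine (crossWigner_conjS_comp he hee' g f (EuclideanSpace.sumEquivProd z).1
      (-(e'.symm (EuclideanSpace.sumEquivProd z).2))).trans ?_
    rw [hneg, Prod.mk.eta, ContinuousLinearEquiv.symm_apply_apply, ← conjS_apply,
      conjS_crossWigner]
  -- The arguments are exchanged and conjugated so that the right-hand side is h on (f ∘ e⁻¹) ⊗
  -- (conj g ∘ e⁻¹). This is what the three changes of variables below, which send h to h(e w, e z),
  -- make of conj g ⊗ f.
  have h1 := (isKernel_weylOp_iff hσ).1 hh (compCLMOfContinuousLinearEquiv ℂ e.symm (conjS g))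
    (compCLMOfContinuousLinearEquiv ℂ e.symm (conjS f))
  have hc : conjS (compCLMOfContinuousLinearEquiv ℂ e.symm (conjS f)) =
      compCLMOfContinuousLinearEquiv ℂ e.symm f := by
    ext
    simp
  rw [hc, ← integral_comp_of_abs_det_eq_one hM] at h1
  rw [distComp_apply_of_abs_det_eq_one hs, compCLM_sndE_symm_tensor,
    distComp_apply_of_abs_det_eq_one (abs_det_swapE _), compCLM_swapE_symm_tensor,
    distComp_apply_of_abs_det_eq_one hs, compCLM_sndE_symm_tensor, ← h1]
  simp only [hW, Function.comp_apply]

/-! ### Symplectic matrices as linear maps of phase space -/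

theorem abs_det_sympE [DecidableEq ι] (S : Matrix.symplecticGroup ι ℝ) :
    |LinearMap.det (sympE S : EuclideanSpace ℝ (ι ⊕ ι) →ₗ[ℝ] EuclideanSpace ℝ (ι ⊕ ι))| = 1 := by
  have h : (sympE S : EuclideanSpace ℝ (ι ⊕ ι) →ₗ[ℝ] EuclideanSpace ℝ (ι ⊕ ι)) =
      Matrix.toLin (EuclideanSpace.basisFun (ι ⊕ ι) ℝ).toBasis
        (EuclideanSpace.basisFun (ι ⊕ ι) ℝ).toBasis S := by
    rw [← Matrix.toEuclideanLin_eq_toLin_orthonormal]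
    rfl
  rw [h, LinearMap.det_toLin, SymplecticGroup.det_eq_one S.2, abs_one]

theorem inner_sympE_transpose [DecidableEq ι] (S : Matrix.symplecticGroup ι ℝ)
    (t ξ : EuclideanSpace ℝ (ι ⊕ ι)) :
    inner ℝ (sympE S t) ξ =
      inner ℝ t (sympE ⟨(S : Matrix (ι ⊕ ι) (ι ⊕ ι) ℝ).transpose,
        SymplecticGroup.transpose_mem S.2⟩ ξ) := by
  change inner ℝ (Matrix.toEuclideanCLM (𝕜 := ℝ) (S : Matrix (ι ⊕ ι) (ι ⊕ ι) ℝ) t) ξ =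
    inner ℝ t (Matrix.toEuclideanCLM (𝕜 := ℝ) (S : Matrix (ι ⊕ ι) (ι ⊕ ι) ℝ).transpose ξ)
  rw [← Matrix.conjTranspose_eq_transpose_of_trivial, ← Matrix.star_eq_conjTranspose, map_star,
    ContinuousLinearMap.star_eq_adjoint, ContinuousLinearMap.adjoint_inner_right]

theorem sympE_inv [DecidableEq ι] (S : Matrix.symplecticGroup ι ℝ) :
    sympE S⁻¹ = (sympE S).symm := by
  refine ContinuousLinearEquiv.ext (funext fun x => ?_)
  rw [ContinuousLinearEquiv.eq_symm_apply]
  change (Matrix.toEuclideanCLM (𝕜 := ℝ) (S : Matrix (ι ⊕ ι) (ι ⊕ ι) ℝ) *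
    Matrix.toEuclideanCLM (𝕜 := ℝ) ((S⁻¹ : Matrix.symplecticGroup ι ℝ) :
      Matrix (ι ⊕ ι) (ι ⊕ ι) ℝ)) x = x
  rw [← map_mul, ← Submonoid.coe_mul, mul_inv_cancel, Submonoid.coe_one, map_one]
  rfl

theorem sndE_symm (e : EuclideanSpace ℝ κ ≃L[ℝ] EuclideanSpace ℝ κ) :
    sndE e.symm = (sndE e).symm :=
  ContinuousLinearEquiv.ext rfl

theorem distComp_sndE_sympE_inv [DecidableEq ι] (S : Matrix.symplecticGroup ι ℝ)
    (U : 𝓢'(EuclideanSpace ℝ ((ι ⊕ ι) ⊕ (ι ⊕ ι)), ℂ)) :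
    distComp (sndE (sympE S⁻¹)) (distComp (sndE (sympE S)) U) = U := by
  have hs := fun S : Matrix.symplecticGroup ι ℝ => abs_det_sndE (abs_det_sympE S)
  ext φ
  rw [distComp_apply_of_abs_det_eq_one (hs _), distComp_apply_of_abs_det_eq_one (hs _)]
  congr 1
  ext z
  rw [sympE_inv, sndE_symm]
  exact congrArg φ ((sndE (sympE S)).apply_symm_apply z)

end

theorem corollary4p5 (d : ℕ) (S : Matrix.symplecticGroup (Fin d) ℝ)
    (T : 𝓢(EuclideanSpace ℝ (Fin d), ℂ) →L[ℂ] 𝓢'(EuclideanSpace ℝ (Fin d), ℂ))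
    (hT : IsFIO S T) :
    IsFIO S⁻¹ (adjointOp T) ∧
    (∀ k, IsWignerKernel T k → IsWignerKernel (adjointOp T) (distComp (swapE (Fin d ⊕ Fin d)) k)) ∧
    (∀ A : Lp ℂ 2 (volume : Measure (EuclideanSpace ℝ (Fin d))) →L[ℂ]
        Lp ℂ 2 (volume : Measure (EuclideanSpace ℝ (Fin d))),
      IsRestriction A T → IsRestriction (ContinuousLinearMap.adjoint A) (adjointOp T)) := by
  refine ⟨?_, fun k hk => isWignerKernel_adjointOp hk, fun A hA => isRestriction_adjointOp hA⟩
  obtain ⟨k, hk, σ, hσ, h, hh, rfl⟩ := hT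
  obtain ⟨σ', hσ', hh'⟩ := isKernel_weylOp_comp (abs_det_sympE S) (abs_det_sympE _)
    (inner_sympE_transpose S) hσ hh
  -- The kernel h(Sw,Sz) is the swapped kernel of T composed with (z,w) ↦ (z,Sw); composing further
  -- with (z,w) ↦ (z,S⁻¹w) recovers the swapped kernel, as membership in FIO(S⁻¹) demands.
  exact ⟨_, isWignerKernel_adjointOp hk, σ', hσ', _, hh', (distComp_sndE_sympE_inv S _).symm⟩
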